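/- Let $K$ be a compact Hausdorff space that is scattered, i.e. for every closed subspace $Y$ of $K$ the set of isolated points of $Y$ is dense in $Y$. Define the Cantor–Bendixson derivatives of $K$ by $K^{(0)}=K$, $K^{(\alpha+1)}=$ the set of non-isolated points of the subspace $K^{(\alpha)}$, and $K^{(\alpha)}=\bigcap_{\beta<\alpha}K^{(\beta)}$ for limit ordinals $\alpha$; the height of $K$ is the least ordinal $\alpha$ with $K^{(\alpha)}=\emptyset$. Assume that the height of $K$ is at most $\omega+1$. Let $C(K)$ be the Banach space of continuous functions $K\to\mathbb{R}$ with the supremum norm. Then the following are equivalent: (i) $C(K)$ has the $c_0$-extension property: for every closed linear subspace $Y$ of $C(K)$, every bounded linear operator $Y\to c_0$ (where $c_0$ is the Banach space of real sequences converging to $0$, with the supremum norm) extends to a bounded linear operator $C(K)\to c_0$. (ii) $K$ is monolithic: every separable subspace of $K$ is second countable. -/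

import Mathlib

open scoped ZeroAtInfty

/-- A real normed space `X` has the `c₀`-extension property if every bounded operator
`T : Y → c₀` defined on a closed subspace `Y` of `X` extends to a bounded operator `X → c₀`.
Here `c₀` is the space `C₀(ℕ, ℝ)` of real sequences tending to `0`, with the supremum norm. -/
def HasC0ExtensionProperty (X : Type*) [NormedAddCommGroup X] [NormedSpace ℝ X] : Prop :=
  ∀ Y : Submodule ℝ X, IsClosed (Y : Set X) → ∀ T : Y →L[ℝ] C₀(ℕ, ℝ),
    ∃ S : X →L[ℝ] C₀(ℕ, ℝ), ∀ y : Y, S (y : X) = T y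

/-- A space is monolithic if every separable subspace of it is second countable. -/
def IsMonolithic (K : Type*) [TopologicalSpace K] : Prop :=
  ∀ A : Set K, TopologicalSpace.SeparableSpace A → SecondCountableTopology A

/-- A space is scattered if in every closed subspace `Y` the isolated points of `Y`
are dense in `Y`. -/
def IsScatteredSpace (K : Type*) [TopologicalSpace K] : Prop :=
  ∀ Y : Set K, IsClosed Y → Dense {y : Y | IsOpen ({y} : Set Y)}

/-- The `α`-th Cantor–Bendixson derivative of the whole space `K`. -/
def cbDerivative (K : Type*) [TopologicalSpace K] (α : Ordinal) : Set K :=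
  CantorBendixson.iteratedDerivedSet (Set.univ : Set K) α

/-- The height of a scattered space `K`: the least ordinal `α` for which the `α`-th
Cantor–Bendixson derivative of `K` is empty. (For a scattered space such an ordinal exists.) -/
noncomputable def scatteredHeight (K : Type*) [TopologicalSpace K] : Ordinal :=
  sInf {α : Ordinal | cbDerivative K α = ∅}

open Filter Topology

/-! Monolithic implies extension: by Hahn–Banach the coordinates of `T` extend to functionals on
`C(K)`. Since `K` is scattered, each is carried by a countable set, so all are carried by one
separable closed `L`, which is second countable. Then `C(L)` is separable and Sobczyk's argument
applies (`exists_pointwise_null_extension`): limits of the functionals annihilate `Y`, so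
subtracting nearby annihilators makes them pointwise null.

Conversely, let the isolated points of a closed `F` be countable and dense in `F`. Evaluating at
them sends functions vanishing on the derived set `F'` into `c₀`. If `S` extends this operator, the
differences between evaluations and coordinates of `S` are carried by `F'`; each is large at only
finitely many isolated points of `F'`, yet each such point is detected, so they are countable.
Iterating through the finite levels, with level `ω` finite by the height bound, makes closures of
countable sets countable. -/

/-- A pointwise bounded sequence of functionals dominated by a separable seminorm which is null on a
subspace `Y` can be corrected by functionals vanishing on `Y` to a pointwise null sequence. -/
theorem exists_pointwise_null_extension {E : Type*} [AddCommGroup E] [Module ℝ E]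
    (p : Seminorm ℝ E) (D : ℕ → E) (hD : ∀ f : E, ∀ ε > 0, ∃ i, p (f - D i) < ε)
    (Y : Submodule ℝ E) {M : ℝ} (hM : 0 ≤ M) (x : ℕ → E →ₗ[ℝ] ℝ)
    (hx : ∀ n f, |x n f| ≤ M * p f)
    (hY : ∀ y ∈ Y, Tendsto (fun n => x n y) atTop (𝓝 0)) :
    ∃ s : ℕ → E →ₗ[ℝ] ℝ, (∀ n, ∀ y ∈ Y, s n y = x n y) ∧
      (∀ n f, |s n f| ≤ 2 * M * p f) ∧ ∀ f, Tendsto (fun n => s n f) atTop (𝓝 0) := by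
  classical
  let F : Set (E →ₗ[ℝ] ℝ) := {ψ | (∀ f, |ψ f| ≤ M * p f) ∧ ∀ y ∈ Y, ψ y = 0}
  let P : ℕ → ℕ → Prop := fun k n =>
    ∃ ψ ∈ F, ∀ i < k, |x n (D i) - ψ (D i)| < 1 / ((k : ℝ) + 1)
  have hP0 : ∀ n, P 0 n := fun n =>
    ⟨0, ⟨fun f => by simpa using mul_nonneg hM (apply_nonneg p f), fun _ _ => rfl⟩, by simp⟩
  have hP : ∀ k, ∀ᶠ n in atTop, P k n := by
    intro k
    by_contra hbad
    rw [not_eventually, frequently_iff_neBot] at hbad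
    -- Limits along an ultrafilter of bad indices give an element of `F` approximating some bad `x
    -- n`.
    let U : Ultrafilter ℕ := Ultrafilter.of (atTop ⊓ 𝓟 {n | ¬ P k n})
    have hU : (U : Filter ℕ) ≤ atTop ⊓ 𝓟 {n | ¬ P k n} := Ultrafilter.of_le _
    have hlim : ∀ f, ∃ a : ℝ, Tendsto (fun n => x n f) U (𝓝 a) ∧ |a| ≤ M * p f := by
      intro f
      have hc : IsCompact (Set.Icc (-(M * p f)) (M * p f)) := isCompact_Icc
      obtain ⟨a, ha, ha'⟩ := hc.ultrafilter_le_nhds (U.map (fun n => x n f)) (by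
        rw [le_principal_iff, Ultrafilter.mem_coe, Ultrafilter.mem_map]
        exact Filter.mem_of_superset Filter.univ_mem fun n _ => abs_le.mp (hx n f))
      exact ⟨a, ha', abs_le.mpr ha⟩
    choose a ha hab using hlim
    let ψ : E →ₗ[ℝ] ℝ :=
      { toFun := a
        map_add' := fun f g => tendsto_nhds_unique (ha (f + g))
          (by simpa using (ha f).add (ha g))
        map_smul' := fun c f => tendsto_nhds_unique (ha (c • f))
          (by simpa using (ha f).const_mul c) }
    have hψ : ψ ∈ F := ⟨hab, fun y hy =>
      tendsto_nhds_unique (ha y) ((hY y hy).mono_left (hU.trans inf_le_left))⟩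
    have hev : ∀ᶠ n in (U : Filter ℕ), ∀ i ∈ Finset.range k,
        |x n (D i) - ψ (D i)| < 1 / ((k : ℝ) + 1) := by
      rw [Filter.eventually_all_finset]
      intro i _
      have h := Metric.tendsto_nhds.mp (ha (D i)) (1 / ((k : ℝ) + 1)) (by positivity)
      simp only [Real.dist_eq] at h
      exact h
    have hnot : ∀ᶠ n in (U : Filter ℕ), ¬ P k n :=
      (hU.trans inf_le_right) (mem_principal_self _)
    obtain ⟨n, hn, hn'⟩ := (hev.and hnot).exists
    exact hn' ⟨ψ, hψ, fun i hi => hn i (Finset.mem_range.mpr hi)⟩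
  -- The best precision `k ≤ n` available at index `n`; it tends to infinity.
  let κ : ℕ → ℕ := fun n => Nat.findGreatest (fun k => P k n) n
  have hκ : ∀ n, P (κ n) n := fun n => Nat.findGreatest_spec (P := fun k => P k n)
    (Nat.zero_le n) (hP0 n)
  have hκle : ∀ k, ∀ᶠ n in atTop, k ≤ κ n := by
    intro k
    filter_upwards [hP k, eventually_ge_atTop k] with n h1 h2
    exact Nat.le_findGreatest h2 h1
  choose ψ hψF hψ using hκ
  have hbound : ∀ n f, |(x n - ψ n) f| ≤ 2 * M * p f := by
    intro n f
    have h1 := hx n f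
    have h2 := (hψF n).1 f
    have h3 : |x n f - ψ n f| ≤ |x n f| + |ψ n f| := abs_sub _ _
    simp only [LinearMap.sub_apply]
    linarith
  refine ⟨fun n => x n - ψ n, fun n y hy => by simp [(hψF n).2 y hy], hbound, fun f => ?_⟩
  rw [Metric.tendsto_nhds]
  intro ε hε
  -- The `+ 1` keeps the denominator positive when `M = 0`.
  obtain ⟨i, hi⟩ := hD f (ε / (2 * (2 * M + 1))) (by positivity)
  obtain ⟨k, hk⟩ := exists_nat_one_div_lt (half_pos hε)
  filter_upwards [hκle (max k (i + 1))] with n hn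
  have h1 := hψ n i (by omega)
  have h2 : (1 : ℝ) / ((κ n : ℝ) + 1) ≤ 1 / ((k : ℝ) + 1) := by
    apply one_div_le_one_div_of_le (by positivity)
    have : (k : ℝ) ≤ κ n := by exact_mod_cast (le_max_left _ _).trans hn
    linarith
  have h3 := hbound n (f - D i)
  have h4 : 2 * M * p (f - D i) ≤ ε / 2 := by
    have : p (f - D i) * (2 * (2 * M + 1)) < ε := (lt_div_iff₀ (by positivity)).mp hi
    nlinarith [apply_nonneg p (f - D i)]
  have h5 : (x n - ψ n) f = (x n - ψ n) (f - D i) + (x n (D i) - ψ n (D i)) := by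
    simp only [map_sub, LinearMap.sub_apply]; ring
  rw [Real.dist_eq, sub_zero, h5]
  calc _ ≤ |(x n - ψ n) (f - D i)| + |x n (D i) - ψ n (D i)| := abs_add_le _ _
    _ < ε := by linarith

/-- A uniformly bounded, pointwise null sequence of functionals defines an operator into `c₀`. -/
theorem exists_clm_of_pointwise_null {X : Type*} [NormedAddCommGroup X] [NormedSpace ℝ X]
    (s : ℕ → X →ₗ[ℝ] ℝ) {C : ℝ} (hC : 0 ≤ C) (hs : ∀ n f, |s n f| ≤ C * ‖f‖)
    (hlim : ∀ f, Tendsto (fun n => s n f) atTop (𝓝 0)) :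
    ∃ S : X →L[ℝ] C₀(ℕ, ℝ), ∀ f n, S f n = s n f := by
  let S : X →ₗ[ℝ] C₀(ℕ, ℝ) :=
    { toFun := fun f =>
        ⟨⟨fun n => s n f, continuous_of_discreteTopology⟩, by
          simpa [Nat.cofinite_eq_atTop] using hlim f⟩
      map_add' := fun f g => by ext n; exact map_add (s n) f g
      map_smul' := fun c f => by ext n; exact map_smul (s n) c f }
  refine ⟨S.mkContinuous C fun f => ?_, fun f n => rfl⟩
  rw [← ZeroAtInftyContinuousMap.norm_toBCF_eq_norm,
    BoundedContinuousFunction.norm_le (by positivity)]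
  exact fun n => hs n f

theorem ZeroAtInftyContinuousMap.abs_apply_le_norm (f : C₀(ℕ, ℝ)) (n : ℕ) : |f n| ≤ ‖f‖ := by
  rw [← ZeroAtInftyContinuousMap.norm_toBCF_eq_norm]
  exact BoundedContinuousFunction.norm_coe_le_norm f.toBCF n

theorem ZeroAtInftyContinuousMap.tendsto_atTop_zero (f : C₀(ℕ, ℝ)) :
    Tendsto (fun n => f n) atTop (𝓝 0) := by
  have h := f.zero_at_infty'
  rw [Filter.cocompact_eq_cofinite, Nat.cofinite_eq_atTop] at h
  exact h

/-- Evaluation at `n` as a bounded functional on `c₀`. -/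
noncomputable def c0EvalCLM (n : ℕ) : C₀(ℕ, ℝ) →L[ℝ] ℝ :=
  LinearMap.mkContinuous
    { toFun := fun f => f n
      map_add' := fun _ _ => rfl
      map_smul' := fun _ _ => rfl } 1
    fun f => by simpa using f.abs_apply_le_norm n

/-- In a scattered space, the isolated points of a closed set are dense in it. -/
theorem IsScatteredSpace.subset_closure {K : Type*} [TopologicalSpace K]
    (hK : IsScatteredSpace K) {S : Set K} (hS : IsClosed S) :
    S ⊆ closure {x | x ∈ S ∧ IsClosed (S \ {x})} := by
  intro x hx
  have h := hK S hS ⟨x, hx⟩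
  have h2 := image_closure_subset_closure_image continuous_subtype_val (Set.mem_image_of_mem _ h)
  refine closure_mono ?_ h2
  rintro _ ⟨y, hy, rfl⟩
  refine ⟨y.2, ?_⟩
  have h3 := hS.isClosedEmbedding_subtypeVal.isClosedMap _ (isClosed_compl_iff.mpr hy)
  convert h3 using 1
  ext z
  simp only [Set.mem_sdiff, Set.mem_singleton_iff, Set.mem_image, Set.mem_compl_iff]
  constructor
  · rintro ⟨h4, h5⟩
    exact ⟨⟨z, h4⟩, fun h6 => h5 (congrArg Subtype.val h6), rfl⟩
  · rintro ⟨w, hw, rfl⟩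
    exact ⟨w.2, fun h6 => hw (Subtype.ext h6)⟩

/-! ### Functionals on `C(K)` and their supports -/

section Compact

variable {K : Type*} [TopologicalSpace K] [CompactSpace K]

/-- A continuous function can be truncated, without changing it on a set where it is bounded
by `c`, to a function of norm at most `c`. -/
theorem ContinuousMap.exists_eqOn_norm_le (f : C(K, ℝ)) (A : Set K) {c : ℝ} (hc : 0 ≤ c)
    (hf : ∀ x ∈ A, |f x| ≤ c) : ∃ g : C(K, ℝ), (∀ x ∈ A, g x = f x) ∧ ‖g‖ ≤ c := by
  refine ⟨⟨fun x => max (-c) (min c (f x)), by fun_prop⟩, fun x hx => ?_, ?_⟩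
  · have := abs_le.mp (hf x hx)
    simp [this.1, this.2]
  · rw [ContinuousMap.norm_le _ hc]
    intro x
    rw [Real.norm_eq_abs, abs_le]
    exact ⟨le_max_left _ _, max_le (by linarith) (min_le_left _ _)⟩

/-- A bounded functional depending only on the values on `S` exceeds `ε > 0` on the indicators of
only finitely many isolated points of `S`. -/
theorem finite_setOf_lt_apply_indicator (S : Set K) (Ψ : C(K, ℝ) →L[ℝ] ℝ)
    (hΨ : ∀ f : C(K, ℝ), (∀ x ∈ S, f x = 0) → Ψ f = 0) {ε : ℝ} (hε : 0 < ε) :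
    {x | x ∈ S ∧ ∃ h : C(K, ℝ), h x = 1 ∧ (∀ y ∈ S, y ≠ x → h y = 0) ∧ ε < Ψ h}.Finite := by
  classical
  by_contra hinf
  obtain ⟨N, hN⟩ := exists_nat_gt (‖Ψ‖ / ε)
  obtain ⟨G, hG, hcard⟩ := Set.Infinite.exists_subset_card_eq hinf N
  choose! h h1 h0 hlt using fun x (hx : x ∈ G) => (hG hx).2
  -- On `S` this is the indicator of `G`: truncation gives norm at most 1, while `Ψ` is at least `N
  -- * ε`.
  let H : C(K, ℝ) := ∑ x ∈ G, h x
  have hH : ∀ y ∈ S, H y = if y ∈ G then 1 else 0 := by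
    intro y hy
    have : H y = ∑ x ∈ G, if y = x then (1 : ℝ) else 0 := by
      rw [show H y = ∑ x ∈ G, h x y from ContinuousMap.sum_apply _ _ _]
      refine Finset.sum_congr rfl fun x hx => ?_
      split_ifs with hyx
      · rw [hyx, h1 x hx]
      · exact h0 x hx y hy hyx
    rw [this, Finset.sum_ite_eq]
  obtain ⟨g, hg, hgn⟩ := H.exists_eqOn_norm_le S zero_le_one (fun y hy => by
    rw [hH y hy]; split_ifs <;> simp)
  have hΨg : Ψ g = Ψ H := by
    rw [← sub_eq_zero, ← map_sub]
    exact hΨ _ fun y hy => by simp [hg y hy]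
  have hle : Ψ H ≤ ‖Ψ‖ := by
    rw [← hΨg]
    calc Ψ g ≤ ‖Ψ g‖ := le_abs_self _
      _ ≤ ‖Ψ‖ * ‖g‖ := Ψ.le_opNorm g
      _ ≤ ‖Ψ‖ * 1 := by gcongr
      _ = ‖Ψ‖ := mul_one _
  have hge : N * ε ≤ Ψ H := by
    rw [map_sum, ← hcard, ← nsmul_eq_mul]
    exact Finset.card_nsmul_le_sum _ _ _ fun x hx => (hlt x hx).le
  rw [div_lt_iff₀ hε] at hN
  linarith

variable [T2Space K]

/-- The indicator of an isolated point of a closed set extends continuously. -/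
theorem exists_indicator_of_isClosed_diff {S : Set K} {x : K} (hx : IsClosed (S \ {x})) :
    ∃ h : C(K, ℝ), h x = 1 ∧ ∀ y ∈ S, y ≠ x → h y = 0 := by
  obtain ⟨h, h0, h1, -⟩ := exists_continuous_zero_one_of_isClosed hx
    (isClosed_singleton (x := x)) (by simp)
  exact ⟨h, h1 rfl, fun y hy hyx => h0 ⟨hy, hyx⟩⟩

/-- Every bounded functional on `C(K)`, with `K` scattered, has a countable support. -/
theorem IsScatteredSpace.exists_countable_support (hK : IsScatteredSpace K)
    (φ : C(K, ℝ) →L[ℝ] ℝ) :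
    ∃ A : Set K, A.Countable ∧ ∀ f : C(K, ℝ), (∀ a ∈ A, f a = 0) → φ f = 0 := by
  -- The largest ideal inside the kernel of `φ`; its zero set `S` is the support of the representing
  -- measure.
  let J : Ideal C(K, ℝ) :=
    { carrier := {f | ∀ g, φ (g * f) = 0}
      add_mem' := fun {a b} ha hb g => by rw [mul_add, map_add, ha, hb, add_zero]
      zero_mem' := fun g => by rw [mul_zero, map_zero]
      smul_mem' := fun c f hf g => by rw [smul_eq_mul, ← mul_assoc]; exact hf _ }
  have hJ : IsClosed (J : Set C(K, ℝ)) := by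
    have : (J : Set C(K, ℝ)) = ⋂ g, {f | φ (g * f) = 0} := by
      ext f
      simp only [Set.mem_iInter]
      exact Iff.rfl
    rw [this]
    exact isClosed_iInter fun g =>
      isClosed_eq (φ.continuous.comp (continuous_const.mul continuous_id)) continuous_const
  let S : Set K := (ContinuousMap.setOfIdeal J)ᶜ
  have hS : IsClosed S := (ContinuousMap.setOfIdeal_open J).isClosed_compl
  have hmem : ∀ f : C(K, ℝ), (∀ x ∈ S, f x = 0) → f ∈ J := by
    intro f hf
    rw [← ContinuousMap.idealOfSet_ofIdeal_isClosed hJ, ContinuousMap.mem_idealOfSet]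
    exact fun x hx => hf x hx
  have hvan : ∀ f : C(K, ℝ), (∀ x ∈ S, f x = 0) → φ f = 0 := fun f hf => by
    simpa using hmem f hf 1
  refine ⟨{x | x ∈ S ∧ IsClosed (S \ {x})}, ?_, fun f hf => hvan f fun x hx => ?_⟩
  · have hpos := fun n : ℕ =>
      finite_setOf_lt_apply_indicator S φ hvan (Nat.one_div_pos_of_nat (α := ℝ) (n := n))
    have hneg := fun n : ℕ => finite_setOf_lt_apply_indicator S (-φ)
      (fun f hf => by simp [hvan f hf]) (Nat.one_div_pos_of_nat (α := ℝ) (n := n))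
    refine (Set.countable_iUnion fun n =>
      (hpos n).countable.union (hneg n).countable).mono ?_
    rintro x ⟨hxS, hx⟩
    obtain ⟨h, h1, h0⟩ := exists_indicator_of_isClosed_diff hx
    have hne : φ h ≠ 0 := by
      intro hz
      have hhJ : h ∈ J := by
        intro g
        -- On `S` the function `h` lives only at `x`, so there `g * h` equals `g x • h`.
        have : φ (g * h - g x • h) = 0 := by
          refine hvan _ fun y hy => ?_
          by_cases hyx : y = x
          · simp [hyx]
          · simp [h0 y hy hyx]
        rw [map_sub, map_smul, hz, smul_zero, sub_zero] at this
        exact this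
      have := ContinuousMap.notMem_setOfIdeal.mp hxS hhJ
      rw [h1] at this
      exact one_ne_zero this
    rw [Set.mem_iUnion]
    obtain ⟨n, hn⟩ := exists_nat_one_div_lt (abs_pos.mpr hne)
    refine ⟨n, ?_⟩
    rcases lt_abs.mp hn with h2 | h2
    · exact Or.inl ⟨hxS, h, h1, h0, h2⟩
    · exact Or.inr ⟨hxS, h, h1, h0, h2⟩
  · have hcl : closure {x | x ∈ S ∧ IsClosed (S \ {x})} ⊆ {x | f x = 0} :=
      closure_minimal hf (isClosed_eq f.continuous continuous_const)
    exact hcl (hK.subset_closure hS hx)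

/-- A countable compact Hausdorff space is second countable. -/
theorem secondCountableTopology_of_countable [Countable K] : SecondCountableTopology K := by
  have hsep : ∀ q : K × K, ∃ f : C(K, ℝ), q.1 ≠ q.2 → f q.1 ≠ f q.2 := by
    intro q
    by_cases hq : q.1 = q.2
    · exact ⟨0, fun h => absurd hq h⟩
    · obtain ⟨f, h0, h1, -⟩ := exists_continuous_zero_one_of_isClosed
        (isClosed_singleton (x := q.1)) (isClosed_singleton (x := q.2)) (by simpa using hq)
      refine ⟨f, fun _ => ?_⟩
      rw [h0 rfl, h1 rfl]
      simp
  choose f hf using hsep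
  have hcont : Continuous fun (x : K) (q : K × K) => f q x :=
    continuous_pi fun q => (f q).continuous
  have hinj : Function.Injective fun (x : K) (q : K × K) => f q x := fun x y hxy => by
    by_contra hne
    exact hf (x, y) hne (congrFun hxy (x, y))
  exact (hcont.isClosedEmbedding hinj).isEmbedding.secondCountableTopology

/-- If `K` is scattered and monolithic then `C(K)` has the `c₀`-extension property. -/
theorem IsMonolithic.hasC0ExtensionProperty (hM : IsMonolithic K) (hK : IsScatteredSpace K) :
    HasC0ExtensionProperty C(K, ℝ) := by
  intro Y _ T
  choose x hxY hxn using fun n => exists_extension_norm_eq (𝕜 := ℝ) Y ((c0EvalCLM n).comp T)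
  choose A hA hAx using fun n => hK.exists_countable_support (x n)
  let L : Set K := closure (⋃ n, A n)
  have hsep : TopologicalSpace.IsSeparable L :=
    (Set.countable_iUnion hA).isSeparable.closure
  have hL : IsClosed L := isClosed_closure
  have : CompactSpace L := isCompact_iff_compactSpace.mp hL.isCompact
  have : TopologicalSpace.SeparableSpace L := by
    refine ⟨⟨Subtype.val ⁻¹' (⋃ n, A n), ?_, ?_⟩⟩
    · exact (Set.countable_iUnion hA).preimage Subtype.val_injective
    · rw [Subtype.dense_iff]
      intro y hy
      rw [Subtype.image_preimage_coe, Set.inter_eq_right.mpr subset_closure]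
      exact hy
  have : SecondCountableTopology L := hM L inferInstance
  have : TopologicalSpace.SeparableSpace C(L, ℝ) := inferInstance
  let r : C(K, ℝ) →ₗ[ℝ] C(L, ℝ) :=
    { toFun := fun f => f.restrict L
      map_add' := fun _ _ => rfl
      map_smul' := fun _ _ => rfl }
  let p : Seminorm ℝ C(K, ℝ) := (normSeminorm ℝ C(L, ℝ)).comp r
  have hp : ∀ f, p f = ‖r f‖ := fun f => rfl
  have hpapply : ∀ f : C(K, ℝ), ∀ y ∈ L, |f y| ≤ p f := fun f y hy =>
    (r f).norm_coe_le_norm ⟨y, hy⟩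
  have hple : ∀ f, p f ≤ ‖f‖ := fun f => by
    rw [hp, ContinuousMap.norm_le _ (norm_nonneg _)]
    exact fun y => f.norm_coe_le_norm y
  choose D hD using fun i =>
    ContinuousMap.exists_restrict_eq hL (TopologicalSpace.denseSeq C(L, ℝ) i)
  have hDdense : ∀ f : C(K, ℝ), ∀ ε > 0, ∃ i, p (f - D i) < ε := by
    intro f ε hε
    obtain ⟨i, hi⟩ := Metric.denseRange_iff.mp
      (TopologicalSpace.denseRange_denseSeq C(L, ℝ)) (r f) ε hε
    refine ⟨i, ?_⟩
    rw [hp, map_sub, ← dist_eq_norm]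
    rwa [← hD i] at hi
  have hc0 : ∀ n, ‖c0EvalCLM n‖ ≤ 1 := fun n => LinearMap.mkContinuous_norm_le _ zero_le_one _
  have hxT : ∀ n, ‖x n‖ ≤ ‖T‖ := fun n => by
    rw [hxn]
    calc _ ≤ ‖c0EvalCLM n‖ * ‖T‖ := ContinuousLinearMap.opNorm_comp_le _ _
      _ ≤ 1 * ‖T‖ := by gcongr; exact hc0 n
      _ = ‖T‖ := one_mul _
  have hxp : ∀ n f, |x n f| ≤ ‖T‖ * p f := by
    intro n f
    obtain ⟨g, hg, hgn⟩ := f.exists_eqOn_norm_le L (apply_nonneg p f) (hpapply f)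
    have hfg : x n f = x n g := by
      rw [← sub_eq_zero, ← map_sub]
      refine hAx n _ fun a ha => ?_
      have haL : a ∈ L := subset_closure (Set.mem_iUnion_of_mem n ha)
      simp [hg a haL]
    rw [hfg]
    calc |x n g| ≤ ‖x n‖ * ‖g‖ := (x n).le_opNorm g
      _ ≤ ‖T‖ * p f := by gcongr; exact hxT n
  obtain ⟨s, hsY, hsp, hs0⟩ := exists_pointwise_null_extension p D hDdense Y (norm_nonneg T)
    (fun n => (x n).toLinearMap) hxp (fun y hy => by
      have h := (T ⟨y, hy⟩).tendsto_atTop_zero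
      refine h.congr fun n => ?_
      exact (hxY n ⟨y, hy⟩).symm)
  obtain ⟨S, hS⟩ := exists_clm_of_pointwise_null s (C := 2 * ‖T‖) (by positivity)
    (fun n f => (hsp n f).trans (by gcongr; exact hple f)) hs0
  refine ⟨S, fun y => ?_⟩
  ext n
  rw [hS, hsY n y y.2]
  exact hxY n y

end Compact

/-! ### Cantor–Bendixson levels and the converse -/

theorem isClosed_diff_singleton_of_notMem_derivedSet {X : Type*} [TopologicalSpace X] {S : Set X}
    (hS : IsClosed S) {x : X} (hx : x ∉ derivedSet S) : IsClosed (S \ {x}) := by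
  rw [mem_derivedSet, accPt_principal_iff_clusterPt, ← mem_closure_iff_clusterPt] at hx
  refine isClosed_of_closure_subset fun y hy => ⟨?_, ?_⟩
  · exact closure_minimal Set.sdiff_subset hS hy
  · rintro rfl
    exact hx hy

theorem notMem_derivedSet_of_isClosed_diff_singleton {X : Type*} [TopologicalSpace X] {S : Set X}
    {x : X} (hx : IsClosed (S \ {x})) : x ∉ derivedSet S := by
  rw [mem_derivedSet, accPt_principal_iff_clusterPt, ← mem_closure_iff_clusterPt, hx.closure_eq]
  exact fun h => h.2 rfl

open CantorBendixson in
/-- The Cantor–Bendixson derivative of a scattered space at its height is empty. -/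
theorem IsScatteredSpace.cbDerivative_scatteredHeight {K : Type*} [TopologicalSpace K]
    [T1Space K] (hK : IsScatteredSpace K) :
    cbDerivative K (scatteredHeight K) = ∅ := by
  refine csInf_mem (s := {α : Ordinal | cbDerivative K α = ∅}) ?_
  obtain ⟨a, ha⟩ := iteratedDerivedSet_mem_fixedPoints (Set.univ : Set K)
  have hcl : IsClosed (cbDerivative K a) := isClosed_iteratedDerivedSet isClosed_univ a
  refine ⟨a, ?_⟩
  have hfix : derivedSet (cbDerivative K a) = cbDerivative K a := by
    rw [← hcl.relDerivedSet_eq]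
    exact ha
  refine Set.eq_empty_of_forall_notMem fun x hx => ?_
  obtain ⟨y, -, hy, hy'⟩ := mem_closure_iff.mp (hK.subset_closure hcl hx) _ isOpen_univ trivial
  exact notMem_derivedSet_of_isClosed_diff_singleton hy' (hfix.symm ▸ hy)

section Compact

variable {K : Type*} [TopologicalSpace K] [CompactSpace K]

theorem finite_of_derivedSet_eq_empty {S : Set K} (hS : derivedSet S = ∅) : S.Finite := by
  by_contra hinf
  obtain ⟨z, hz⟩ := Set.Infinite.exists_accPt_principal hinf
  exact Set.notMem_empty z (hS ▸ hz)

/-- A function vanishing on the derived set of `S` is at least `ε > 0` at finitely many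
points of `S` only. -/
theorem finite_setOf_le_abs {S : Set K} {f : C(K, ℝ)} (hf : ∀ x ∈ derivedSet S, f x = 0)
    {ε : ℝ} (hε : 0 < ε) : {x | x ∈ S ∧ ε ≤ |f x|}.Finite := by
  refine finite_of_derivedSet_eq_empty (Set.eq_empty_of_forall_notMem fun z hz => ?_)
  have h1 : f z = 0 := hf z (derivedSet_mono _ _ (fun _ hx => hx.1) hz)
  have h2 : z ∈ closure {x | x ∈ S ∧ ε ≤ |f x|} :=
    mem_closure_iff_clusterPt.mpr (AccPt.clusterPt hz)
  have h3 : closure {x | x ∈ S ∧ ε ≤ |f x|} ⊆ {x | ε ≤ |f x|} :=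
    closure_minimal (fun _ hx => hx.2) (isClosed_le continuous_const f.continuous.abs)
  have h4 : ε ≤ |f z| := h3 h2
  rw [h1, abs_zero] at h4
  linarith

/-- The space of functions vanishing on the derived set of `F` is mapped into `c₀` by evaluation
at countably many points of `F`. -/
theorem exists_clm_eval_of_injective {F I : Set K} (hI : I ⊆ F) {e : I → ℕ}
    (he : Function.Injective e) (Y : Submodule ℝ C(K, ℝ))
    (hY : ∀ f ∈ Y, ∀ x ∈ derivedSet F, f x = 0) :
    ∃ T : Y →L[ℝ] C₀(ℕ, ℝ), ∀ (f : Y) (x : I), T f (e x) = (f : C(K, ℝ)) x := by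
  classical
  let s : ℕ → Y →ₗ[ℝ] ℝ := fun n =>
    if h : ∃ x, e x = n then
      (ContinuousMap.evalCLM ℝ (h.choose : K)).toLinearMap.comp Y.subtype
    else 0
  have hs : ∀ (f : Y) (x : I), s (e x) f = (f : C(K, ℝ)) x := by
    intro f x
    have h : ∃ y, e y = e x := ⟨x, rfl⟩
    simp only [s, dif_pos h]
    exact congrArg (fun z : I => (f : C(K, ℝ)) z) (he h.choose_spec)
  have hs0 : ∀ (f : Y) (n : ℕ), n ∉ Set.range e → s n f = 0 := by
    intro f n hn
    have h : ¬ ∃ y, e y = n := hn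
    simp only [s, dif_neg h, LinearMap.zero_apply]
  obtain ⟨T, hT⟩ := exists_clm_of_pointwise_null (X := Y) s zero_le_one (fun n f => by
    by_cases hn : n ∈ Set.range e
    · obtain ⟨x, rfl⟩ := hn
      rw [hs, one_mul]
      exact (f : C(K, ℝ)).norm_coe_le_norm x
    · rw [hs0 f n hn, abs_zero]
      positivity) (fun f => by
    rw [Metric.tendsto_nhds, ← Nat.cofinite_eq_atTop]
    intro ε hε
    have hfin : {x : I | ε ≤ |(f : C(K, ℝ)) x|}.Finite := by
      refine Set.Finite.of_finite_image ((finite_setOf_le_abs (hY f f.2) hε).subset ?_)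
        Subtype.val_injective.injOn
      rintro _ ⟨x, hx, rfl⟩
      exact ⟨hI x.2, hx⟩
    refine (hfin.image e).subset fun n hn => ?_
    have hn' : ε ≤ |s n f| := by simpa using hn
    by_cases hr : n ∈ Set.range e
    · obtain ⟨x, rfl⟩ := hr
      rw [hs] at hn'
      exact ⟨x, hn', rfl⟩
    · rw [hs0 f n hr, abs_zero] at hn'
      linarith)
  exact ⟨T, fun f x => by rw [hT, hs]⟩

variable [T2Space K]

/-- If `C(K)` has the `c₀`-extension property and a closed set `F` is the closure of a countable
set of isolated points of `F`, then its derived set has only countably many isolated points. -/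
theorem HasC0ExtensionProperty.countable_derivedSet_diff (h : HasC0ExtensionProperty C(K, ℝ))
    {F : Set K} (hF : IsClosed F) (hcount : (F \ derivedSet F).Countable)
    (hdense : F ⊆ closure (F \ derivedSet F)) :
    (derivedSet F \ derivedSet (derivedSet F)).Countable := by
  have := hcount.to_subtype
  obtain ⟨e, he⟩ := exists_injective_nat (F \ derivedSet F : Set K)
  let Y : Submodule ℝ C(K, ℝ) :=
    ⨅ x ∈ derivedSet F, LinearMap.ker (ContinuousMap.evalCLM ℝ x : C(K, ℝ) →L[ℝ] ℝ).toLinearMap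
  have hYmem : ∀ f : C(K, ℝ), f ∈ Y ↔ ∀ x ∈ derivedSet F, f x = 0 := by
    intro f
    simp [Y, Submodule.mem_iInf]
  have hYcl : IsClosed (Y : Set C(K, ℝ)) := by
    have : (Y : Set C(K, ℝ)) = ⋂ x ∈ derivedSet F, {f | f x = 0} := by
      ext f
      simp only [SetLike.mem_coe, hYmem, Set.mem_iInter]
      exact Iff.rfl
    rw [this]
    exact isClosed_biInter fun x _ =>
      isClosed_eq (continuous_eval_const x) continuous_const
  obtain ⟨T, hT⟩ := exists_clm_eval_of_injective Set.sdiff_subset he Y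
    fun f hf => (hYmem f).mp hf
  obtain ⟨S, hS⟩ := h Y hYcl T
  let Ψ : (F \ derivedSet F : Set K) → C(K, ℝ) →L[ℝ] ℝ := fun x =>
    ContinuousMap.evalCLM ℝ (x : K) - (c0EvalCLM (e x)).comp S
  have hΨapply : ∀ x f, Ψ x f = f x - S f (e x) := fun _ _ => rfl
  have hΨ : ∀ x, ∀ f : C(K, ℝ), (∀ y ∈ derivedSet F, f y = 0) → Ψ x f = 0 := by
    intro x f hf
    rw [hΨapply, hS ⟨f, (hYmem f).mpr hf⟩, hT, sub_self]
  refine (Set.countable_iUnion fun x => (finite_setOf_lt_apply_indicator (derivedSet F) (Ψ x) (hΨ x)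
    (one_half_pos (α := ℝ))).countable).mono ?_
  rintro γ ⟨hγ, hγ'⟩
  have hF' : IsClosed (derivedSet F) := isClosed_derivedSet F
  obtain ⟨g, g1, g0⟩ := exists_indicator_of_isClosed_diff
    (isClosed_diff_singleton_of_notMem_derivedSet hF' hγ')
  have hfin : {n | ¬ |S g n| < 1 / 4}.Finite := by
    have := Metric.tendsto_nhds.mp (S g).tendsto_atTop_zero (1 / 4) (by norm_num)
    rw [← Nat.cofinite_eq_atTop] at this
    simpa [Filter.eventually_cofinite] using this
  have hQ : (Subtype.val '' (e ⁻¹' {n | ¬ |S g n| < 1 / 4})).Finite :=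
    (hfin.preimage he.injOn).image _
  -- Deleting finitely many isolated points of `F` keeps a neighbourhood of `γ`; on the remaining
  -- ones `Ψ` exceeds `3/4 - 1/4 = 1/2` at `g`.
  have hV : IsOpen ({y | 3 / 4 < g y} \ Subtype.val '' (e ⁻¹' {n | ¬ |S g n| < 1 / 4})) :=
    (isOpen_lt continuous_const g.continuous).sdiff hQ.isClosed
  have hγF : γ ∈ F := (isClosed_iff_derivedSet_subset F).mp hF hγ
  obtain ⟨y, ⟨hy1, hy2⟩, hyI⟩ := mem_closure_iff.mp (hdense hγF) _ hV
    ⟨by simp only [Set.mem_ofPred, g1]; norm_num, by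
      rintro ⟨z, -, rfl⟩
      exact z.2.2 hγ⟩
  rw [Set.mem_iUnion]
  refine ⟨⟨y, hyI⟩, hγ, g, g1, g0, ?_⟩
  have h1 : |S g (e ⟨y, hyI⟩)| < 1 / 4 := by
    by_contra hcon
    exact hy2 ⟨⟨y, hyI⟩, hcon, rfl⟩
  have h2 := (abs_lt.mp h1).2
  have h3 : 3 / 4 < g y := hy1
  rw [hΨapply]
  change 1 / 2 < g y - S g (e ⟨y, hyI⟩)
  linarith

open CantorBendixson in
/-- If `C(K)` has the `c₀`-extension property then the closure of a countable set is countable,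
provided that `K` is scattered of height at most `ω + 1`. -/
theorem HasC0ExtensionProperty.countable_closure (h : HasC0ExtensionProperty C(K, ℝ))
    (hK : IsScatteredSpace K) (hheight : scatteredHeight K ≤ Ordinal.omega0 + 1)
    {A : Set K} (hA : A.Countable) : (closure A).Countable := by
  let F : Ordinal → Set K := iteratedDerivedSet (closure A)
  have hFcl : ∀ a, IsClosed (F a) := isClosed_iteratedDerivedSet isClosed_closure
  have hFsucc : ∀ a, F (a + 1) = derivedSet (F a) := fun a => by
    rw [← (hFcl a).relDerivedSet_eq]
    exact iteratedDerivedSet_succ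
  have hFdense : ∀ a, F a ⊆ closure (F a \ derivedSet (F a)) := fun a =>
    (hK.subset_closure (hFcl a)).trans (closure_mono fun x hx =>
      ⟨hx.1, notMem_derivedSet_of_isClosed_diff_singleton hx.2⟩)
  have hlevel : ∀ k : ℕ, (F k \ derivedSet (F k)).Countable := by
    intro k
    induction k with
    | zero =>
      have hF0 : F ((0 : ℕ) : Ordinal) = closure A := by
        rw [Nat.cast_zero]
        exact iteratedDerivedSet_zero
      rw [hF0]
      -- An isolated point of `closure A` must belong to `A`.
      refine hA.mono fun x hx => ?_
      by_contra hxA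
      have hsub : A ⊆ closure A \ {x} := fun y hy =>
        ⟨subset_closure hy, fun hyx => hxA (hyx ▸ hy)⟩
      exact (closure_minimal hsub
        (isClosed_diff_singleton_of_notMem_derivedSet isClosed_closure hx.2) hx.1).2 rfl
    | succ k ih =>
      rw [Nat.cast_succ, hFsucc]
      exact h.countable_derivedSet_diff (hFcl k) ih (hFdense k)
  have hempty : F (Ordinal.omega0 + 1) = ∅ := by
    rw [← Set.subset_empty_iff, ← hK.cbDerivative_scatteredHeight]
    exact (iteratedDerivedSet_mono (Set.subset_univ (closure A)) _).trans
      (iteratedDerivedSet_antitone _ hheight)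
  have hfin : (F Ordinal.omega0).Finite :=
    finite_of_derivedSet_eq_empty (by rw [← hFsucc, hempty])
  refine ((Set.countable_iUnion hlevel).union hfin.countable).mono fun x hx => ?_
  by_cases hxω : x ∈ F Ordinal.omega0
  · exact Or.inr hxω
  refine Or.inl ?_
  have hex : ∃ k : ℕ, x ∉ F k := by
    by_contra! hall
    refine hxω ?_
    change x ∈ iteratedDerivedSet (closure A) Ordinal.omega0
    rw [iteratedDerivedSet_limit Ordinal.isSuccLimit_omega0, Set.mem_iInter]
    rintro ⟨b, hb⟩
    obtain ⟨k, rfl⟩ := Ordinal.lt_omega0.mp hb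
    exact hall k
  classical
  -- The predecessor of the first level missing `x` is the level in which `x` is isolated.
  have hne : Nat.find hex ≠ 0 := by
    intro h0
    have := Nat.find_spec hex
    rw [h0, Nat.cast_zero] at this
    exact this (by change x ∈ iteratedDerivedSet (closure A) 0; rwa [iteratedDerivedSet_zero])
  obtain ⟨k, hk⟩ := Nat.exists_eq_succ_of_ne_zero hne
  have h1 : x ∈ F k := by
    by_contra hcon
    have := Nat.find_min' hex hcon
    omega
  have h2 : x ∉ derivedSet (F k) := by
    have := Nat.find_spec hex
    rwa [hk, Nat.cast_succ, hFsucc] at this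
  exact Set.mem_iUnion_of_mem k ⟨h1, h2⟩

theorem HasC0ExtensionProperty.isMonolithic (h : HasC0ExtensionProperty C(K, ℝ))
    (hK : IsScatteredSpace K) (hheight : scatteredHeight K ≤ Ordinal.omega0 + 1) :
    IsMonolithic K := by
  intro A hA
  obtain ⟨B, hB, hBd⟩ := hA.exists_countable_dense
  let L : Set K := closure (Subtype.val '' B)
  have hAL : A ⊆ L := Subtype.dense_iff.mp hBd
  have : Countable L := (h.countable_closure hK hheight (hB.image _)).to_subtype
  have : CompactSpace L := isCompact_iff_compactSpace.mp isClosed_closure.isCompact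
  have : SecondCountableTopology L := secondCountableTopology_of_countable
  exact (Topology.IsEmbedding.inclusion hAL).secondCountableTopology

end Compact

theorem theorem3p15 (K : Type*) [TopologicalSpace K] [CompactSpace K] [T2Space K]
    (hK : IsScatteredSpace K) (hheight : scatteredHeight K ≤ Ordinal.omega0 + 1) :
    HasC0ExtensionProperty C(K, ℝ) ↔ IsMonolithic K :=
  ⟨fun h => h.isMonolithic hK hheight, fun h => h.hasC0ExtensionProperty hK⟩
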